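/- \textbf{Theorem.} \textsc{Possible Kemeny Score} can be solved in polynomial time, more precisely in $O(n\cdot m^3)$ time, where $m$ is the number of candidates and $n$ the number of partial rankings. \emph{The problem.} A ranking over a finite set $S$ lists every element of $S$ exactly once. An instance consists of a set $C$ of $m$ candidates (identified with $\{0,\dots,m-1\}$), a tuple $(R_1,\dots,R_n)$ of partial rankings, where $R_i$ is a ranking over some subset $C_i\subseteq C$, a ranking $X$ over $C$, and an integer $k$. A ranking $R'$ over $C$ \emph{extends} $R_i$ if any two candidates of $C_i$ occur in the same relative order in $R'$ as in $R_i$. The Kendall tau distance $\mathrm{KT}(\pi,\pi')$ of two rankings over $C$ is the number of unordered pairs of candidates whose relative order differs in $\pi$ and $\pi'$. The question is whether there are rankings $R_1',\dots,R_n'$ over $C$ such that $R_i'$ extends $R_i$ for every $i$ and $\sum_{i=1}^n \mathrm{KT}(X,R_i')\le k$. \emph{The claim.} There is a single random access machine program (integer registers and an integer memory; constants, addition, subtraction, indirect load and store, jumps, conditional jumps, halting; no multiplication), a constant $K$ and a polynomial $p$ such that, on every instance, given as the list of integers $k$, $m$, $n$, $X$ and then, for each $i$, the length $|C_i|$ followed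 by $R_i$, the program halts with the correct answer, it executes at most $K\,(n\,m^3+1)$ instructions, and its total bit cost (each executed instruction costs one plus the number of bits of its operands) is at most $p(L)$, where $L$ is the number of bits of the input list. -/

import Mathlib

/-! ### Rankings and the Kendall tau distance -/

namespace PossibleKemeny

/-- A full ranking over `α`: a list in which every candidate occurs exactly once, listed from the
first place to the last. A partial ranking is any list without repetitions. -/
def IsRanking {α : Type} (π : List α) : Prop :=
  π.Nodup ∧ ∀ c, c ∈ π

/-- `x` is before `y` in the ranking `π` (a list without repetitions). -/
def Before {α : Type} (π : List α) (x y : α) : Prop :=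
  [x, y].Sublist π

instance {α : Type} [DecidableEq α] (π : List α) (x y : α) : Decidable (Before π x y) :=
  inferInstanceAs (Decidable ([x, y].Sublist π))

/-- The Kendall tau distance: the number of unordered pairs of candidates whose relative order
differs in `π` and `π'`. Each such pair is counted once, as the ordered pair `(x, y)` where `x`
is the candidate that comes first in `π`. -/
def kendallTau {α : Type} [Fintype α] [DecidableEq α] (π π' : List α) : ℕ :=
  (Finset.univ.filter fun p : α × α => Before π p.1 p.2 ∧ Before π' p.2 p.1).card

/-- `R'` extends the partial ranking `R`: it is a full ranking obtained by adding the missing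
candidates to `R` without changing the relative order of the candidates of `R`. -/
def Extends {α : Type} (R' R : List α) : Prop :=
  IsRanking R' ∧ R.Sublist R'

/-- An instance of the problem: candidates `0, …, m - 1`, a tuple of `n` partial rankings (each of
them over its own subset of the candidates), a full ranking `X` and an integer `k`. -/
structure Input where
  m : ℕ
  n : ℕ
  rankings : Fin n → List (Fin m)
  rankings_nodup : ∀ i, (rankings i).Nodup
  X : List (Fin m)
  X_isRanking : IsRanking X
  k : ℤ

/-- The question: can the partial rankings be extended so that the total Kendall tau distance of
`X` from the extended rankings is at most `k`? -/
def Input.IsYes (I : Input) : Prop :=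
  ∃ R' : Fin I.n → List (Fin I.m),
    (∀ i, Extends (R' i) (I.rankings i)) ∧
      ((∑ i, kendallTau I.X (R' i) : ℕ) : ℤ) ≤ I.k

/-- The candidates of a list as a list of integers. -/
def wordsOf {m : ℕ} (l : List (Fin m)) : List ℤ :=
  l.map fun c => ((c : ℕ) : ℤ)

/-- The instance as a list of integers: `k`, `m`, `n`, the ranking `X`, and then for each partial
ranking its length followed by its candidates in their order. -/
def Input.encode (I : Input) : List ℤ :=
  [I.k, (I.m : ℤ), (I.n : ℤ)] ++ wordsOf I.X ++
    (List.ofFn I.rankings).flatMap fun R => (R.length : ℤ) :: wordsOf R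

end PossibleKemeny

/-! ### Random access machines -/

namespace RAM

/-- Instructions of a random access machine with integer registers `reg 0, reg 1, …` and an
integer memory `mem 0, mem 1, …`. There is no multiplication. -/
inductive Instr where
  /-- `reg d := c` -/
  | const (d : ℕ) (c : ℤ)
  /-- `reg d := reg a + reg b` -/
  | add (d a b : ℕ)
  /-- `reg d := reg a - reg b` -/
  | sub (d a b : ℕ)
  /-- `reg d := mem (reg a)` -/
  | load (d a : ℕ)
  /-- `mem (reg a) := reg b` -/
  | store (a b : ℕ)
  /-- go to instruction `l` -/
  | jump (l : ℕ)
  /-- go to instruction `l` if `reg a > 0` -/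
  | jumpPos (a l : ℕ)
  /-- stop with the answer `b` -/
  | halt (b : Bool)

/-- A program is a finite list of instructions. It uses only finitely many registers, as every
instruction names its registers explicitly; the memory is addressed indirectly. -/
abbrev Program := List Instr

structure Config where
  pc : ℕ
  reg : ℕ → ℤ
  mem : ℕ → ℤ

/-- The initial configuration: the input is in the memory cells `0, 1, …`, and all other cells and
all registers are zero. -/
def init (w : List ℤ) : Config where
  pc := 0
  reg := fun _ => 0
  mem := fun i => w.getD i 0

/-- The effect of one instruction (`none` for `halt`). A negative address counts as `0`. -/
def Instr.exec (s : Config) : Instr → Option Config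
  | const d c => some ⟨s.pc + 1, Function.update s.reg d c, s.mem⟩
  | add d a b => some ⟨s.pc + 1, Function.update s.reg d (s.reg a + s.reg b), s.mem⟩
  | sub d a b => some ⟨s.pc + 1, Function.update s.reg d (s.reg a - s.reg b), s.mem⟩
  | load d a => some ⟨s.pc + 1, Function.update s.reg d (s.mem (s.reg a).toNat), s.mem⟩
  | store a b => some ⟨s.pc + 1, s.reg, Function.update s.mem (s.reg a).toNat (s.reg b)⟩
  | jump l => some ⟨l, s.reg, s.mem⟩
  | jumpPos a l => some ⟨if 0 < s.reg a then l else s.pc + 1, s.reg, s.mem⟩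
  | halt _ => none

/-- The number of bits of an integer: its binary digits and a sign. -/
def bits (z : ℤ) : ℕ := z.natAbs.size + 1

/-- The number of bits of a list of integers. -/
def bitLength (w : List ℤ) : ℕ := (w.map bits).sum

/-- The number of bits handled when an instruction is executed (the logarithmic cost of the
instruction): one plus the bits of its operands, addresses included. -/
def Instr.bitCost (s : Config) : Instr → ℕ
  | const _ c => 1 + bits c
  | add _ a b => 1 + bits (s.reg a) + bits (s.reg b)
  | sub _ a b => 1 + bits (s.reg a) + bits (s.reg b)
  | load _ a => 1 + bits (s.reg a) + bits (s.mem (s.reg a).toNat)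
  | store a b => 1 + bits (s.reg a) + bits (s.reg b)
  | jump _ => 1
  | jumpPos a _ => 1 + bits (s.reg a)
  | halt _ => 1

/-- `Runs P s b t u`: started in the configuration `s`, the program `P` stops with the answer `b`
after executing exactly `t` instructions, of total bit cost `u`. A jump out of the program does
not count as stopping. -/
inductive Runs (P : Program) : Config → Bool → ℕ → ℕ → Prop
  | halt {s : Config} {b : Bool} (h : P[s.pc]? = some (Instr.halt b)) : Runs P s b 1 1
  | step {s s' : Config} {i : Instr} {b : Bool} {t u : ℕ} (hi : P[s.pc]? = some i)
      (hs : i.exec s = some s') (h : Runs P s' b t u) : Runs P s b (t + 1) (u + i.bitCost s)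

end RAM

namespace RAM

/-! ### Bit cost in terms of the number of steps -/

/-! The partial rankings can be treated separately, so it suffices to find, for one partial ranking
R, the least distance of X from an extension of R. Inversions inside R are forced. The inversions of
a missing candidate with R depend only on the gap of R that receives it. Two missing candidates need
not form an inversion at all: if each goes to its first cheapest gap, an exchange argument
(`bestGap_mono`) shows that these gaps are monotone in the order of X, so missing candidates that
share a gap can be listed as in X. All lower bounds are thus attained at once, and the minimum is a
sum over single candidates (`minCost_le_kendallTau`, `exists_extends_kendallTau_eq`).

Each summand comes from one pass over R that keeps two numbers (`scanCost`). The machine makes this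
pass for each of the m candidates and finds the position in X of each entry of R by linear search,
which gives m³ per ranking. It never stores, so the memory is a fixed parameter of a small
structured language with a weakest precondition calculus, compiled to jumps (`Runs.of_exec`). This
calculus counts steps only; the bit cost follows because numbers grow by at most one bit per step
(`Runs.bitCost_le`). -/

theorem bits_add_le {a b : ℤ} {B : ℕ} (ha : bits a ≤ B) (hb : bits b ≤ B) :
    bits (a + b) ≤ B + 1 := by
  unfold bits at *
  obtain ⟨B, rfl⟩ : ∃ B', B = B' + 1 := ⟨B - 1, by omega⟩
  have ha' : a.natAbs < 2 ^ B := Nat.size_le.1 (by omega)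
  have hb' : b.natAbs < 2 ^ B := Nat.size_le.1 (by omega)
  have : (a + b).natAbs.size ≤ B + 1 := Nat.size_le.2 (by
    have := Int.natAbs_add_le a b
    rw [pow_succ]; omega)
  omega

theorem bits_neg (a : ℤ) : bits (-a) = bits a := by simp [bits]

theorem bits_sub_le {a b : ℤ} {B : ℕ} (ha : bits a ≤ B) (hb : bits b ≤ B) :
    bits (a - b) ≤ B + 1 := by
  rw [sub_eq_add_neg]
  exact bits_add_le ha (by rwa [bits_neg])

/-- All numbers in the registers and in the memory have at most `B` bits. -/
def Config.BitBound (s : Config) (B : ℕ) : Prop :=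
  (∀ i, bits (s.reg i) ≤ B) ∧ ∀ i, bits (s.mem i) ≤ B

theorem bits_update_le {f : ℕ → ℤ} {B : ℕ} (hf : ∀ i, bits (f i) ≤ B) {v : ℤ} {d : ℕ}
    (hv : bits v ≤ B + 1) (i : ℕ) : bits (Function.update f d v i) ≤ B + 1 := by
  by_cases h : i = d
  · subst h; simpa using hv
  · simpa [h] using (hf i).trans B.le_succ

theorem Instr.exec_bitBound {s s' : Config} {i : Instr} {B : ℕ} (hs : s.BitBound B)
    (hc : ∀ d c, i = .const d c → bits c ≤ B) (h : i.exec s = some s') :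
    s'.BitBound (B + 1) := by
  obtain ⟨hr, hm⟩ := hs
  have hr' := fun i => (hr i).trans B.le_succ
  have hm' := fun i => (hm i).trans B.le_succ
  cases i <;> simp only [Instr.exec, Option.some.injEq, reduceCtorEq] at h <;> subst h
  case const d c => exact ⟨bits_update_le hr ((hc d c rfl).trans B.le_succ), hm'⟩
  case add d a b => exact ⟨bits_update_le hr (bits_add_le (hr a) (hr b)), hm'⟩
  case sub d a b => exact ⟨bits_update_le hr (bits_sub_le (hr a) (hr b)), hm'⟩
  case load d a => exact ⟨bits_update_le hr (hm' _), hm'⟩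
  case store a b => exact ⟨hr', bits_update_le hm (hr' b)⟩
  all_goals exact ⟨hr', hm'⟩

theorem Instr.bitCost_le {s : Config} {i : Instr} {B : ℕ} (hs : s.BitBound B)
    (hc : ∀ d c, i = .const d c → bits c ≤ B) : i.bitCost s ≤ 1 + 2 * B := by
  obtain ⟨hr, hm⟩ := hs
  cases i <;> simp only [Instr.bitCost]
  case const d c => have := hc d c rfl; omega
  case add d a b => have := hr a; have := hr b; omega
  case sub d a b => have := hr a; have := hr b; omega
  case load d a => have := hr a; have := hm (s.reg a).toNat; omega
  case store a b => have := hr a; have := hr b; omega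
  case jumpPos a l => have := hr a; omega
  all_goals omega

/-- One instruction lengthens the numbers by at most one bit, so during t steps they stay within B +
t bits; an instruction handles at most two of them. -/
theorem Runs.bitCost_le {P : Program} {s : Config} {b : Bool} {t u : ℕ} (h : Runs P s b t u) :
    ∀ B : ℕ, s.BitBound B → (∀ d c, Instr.const d c ∈ P → bits c ≤ B) →
      u ≤ t * (1 + 2 * (B + t)) := by
  induction h with
  | halt h => intro B _ _; omega
  | @step s s' i b t u hi hs _ ih =>
    intro B hB hP
    have hc : ∀ d c, i = .const d c → bits c ≤ B := by
      rintro d c rfl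
      exact hP d c (List.mem_of_getElem? hi)
    have h1 := ih (B + 1) (Instr.exec_bitBound hB hc hs)
      fun d c h => (hP d c h).trans B.le_succ
    have h2 := Instr.bitCost_le hB hc
    nlinarith

/-! ### A structured language without stores -/

/-- Commands: single instructions, sequences, conditionals and loops on the sign of a register. -/
inductive Cmd where
  | instr (i : Instr)
  | seq (c c' : Cmd)
  | ifPos (a : ℕ) (c c' : Cmd)
  | whilePos (a : ℕ) (c : Cmd)

/-- `Exec M c s s' t`: with the memory `M`, the command `c` takes the registers from `s` to `s'`
in `t` steps. -/
inductive Exec (M : ℕ → ℤ) : Cmd → (ℕ → ℤ) → (ℕ → ℤ) → ℕ → Prop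
  | instr {i : Instr} {s s' : ℕ → ℤ}
      (h : ∀ pc, i.exec ⟨pc, s, M⟩ = some ⟨pc + 1, s', M⟩) : Exec M (.instr i) s s' 1
  | seq {c c' : Cmd} {s s' s'' : ℕ → ℤ} {t t' : ℕ} (h : Exec M c s s' t)
      (h' : Exec M c' s' s'' t') : Exec M (.seq c c') s s'' (t + t')
  | ifPos {a : ℕ} {c c' : Cmd} {s s' : ℕ → ℤ} {t : ℕ} (ha : 0 < s a) (h : Exec M c s s' t) :
      Exec M (.ifPos a c c') s s' (t + 1)
  | ifNonpos {a : ℕ} {c c' : Cmd} {s s' : ℕ → ℤ} {t : ℕ} (ha : ¬ 0 < s a)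
      (h : Exec M c' s s' t) : Exec M (.ifPos a c c') s s' (t + 2)
  | whileStop {a : ℕ} {c : Cmd} {s : ℕ → ℤ} (ha : ¬ 0 < s a) : Exec M (.whilePos a c) s s 2
  | whileStep {a : ℕ} {c : Cmd} {s s' s'' : ℕ → ℤ} {t t' : ℕ} (ha : 0 < s a)
      (h : Exec M c s s' t) (h' : Exec M (.whilePos a c) s' s'' t') :
      Exec M (.whilePos a c) s s'' (t + t' + 2)

/-- The number of instructions of a compiled command. -/
def Cmd.size : Cmd → ℕ
  | instr _ => 1
  | seq c c' => c.size + c'.size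
  | ifPos _ c c' => c'.size + c.size + 2
  | whilePos _ c => c.size + 3

/-- The code of a command that starts at the position `o` of the program. -/
def Cmd.compile : Cmd → ℕ → Program
  | instr i, _ => [i]
  | seq c c', o => c.compile o ++ c'.compile (o + c.size)
  | ifPos a c c', o =>
    [.jumpPos a (o + c'.size + 2)] ++ c'.compile (o + 1) ++
      [.jump (o + c'.size + c.size + 2)] ++ c.compile (o + c'.size + 2)
  | whilePos a c, o =>
    [.jumpPos a (o + 2), .jump (o + c.size + 3)] ++ c.compile (o + 2) ++ [.jump o]

@[simp]
theorem Cmd.length_compile (c : Cmd) (o : ℕ) : (c.compile o).length = c.size := by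
  induction c generalizing o with
  | instr i => rfl
  | seq c c' ih ih' => simp [compile, size, ih, ih']
  | ifPos a c c' ih ih' => simp [compile, size, ih, ih']; omega
  | whilePos a c ih => simp [compile, size, ih]

/-- The list `l` stands in `P` from the position `o` on. -/
def CodeAt (P : Program) (o : ℕ) (l : Program) : Prop :=
  ∀ j (h : j < l.length), P[o + j]? = some l[j]

theorem codeAt_append {P : Program} {o : ℕ} {l l' : Program} :
    CodeAt P o (l ++ l') ↔ CodeAt P o l ∧ CodeAt P (o + l.length) l' := by
  constructor
  · intro h
    refine ⟨fun j hj => ?_, fun j hj => ?_⟩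
    · rw [h j (by simp; omega), List.getElem_append_left hj]
    · rw [add_assoc, h (l.length + j) (by simp; omega), List.getElem_append_right (by omega)]
      simp
  · rintro ⟨h, h'⟩ j hj
    by_cases hl : j < l.length
    · rw [h j hl, List.getElem_append_left hl]
    · rw [List.getElem_append_right (by omega)]
      have := h' (j - l.length) (by simp at hj; omega)
      rw [← this]; congr 1; omega

theorem codeAt_singleton {P : Program} {o : ℕ} {i : Instr} :
    CodeAt P o [i] ↔ P[o]? = some i := by
  constructor
  · intro h; exact h 0 (by simp)
  · intro h j hj
    obtain rfl : j = 0 := by simpa using hj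
    exact h

theorem codeAt_cons {P : Program} {o : ℕ} {i : Instr} {l : Program} :
    CodeAt P o (i :: l) ↔ P[o]? = some i ∧ CodeAt P (o + 1) l := by
  rw [← codeAt_singleton]
  exact codeAt_append (l := [i])

/-- Stated with a continuation, so that code pieces compose by induction: a run from the end of the
code extends backwards to one from its start. -/
theorem Runs.of_exec {P : Program} {M : ℕ → ℤ} {c : Cmd} {s s' : ℕ → ℤ} {t : ℕ}
    (h : Exec M c s s' t) : ∀ {o : ℕ}, CodeAt P o (c.compile o) → ∀ {b : Bool} {t' u' : ℕ},
      Runs P ⟨o + c.size, s', M⟩ b t' u' → ∃ u, Runs P ⟨o, s, M⟩ b (t + t') u := by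
  induction h with
  | @instr i s s' h =>
    intro o hc b t' u' hr
    rw [add_comm]
    exact ⟨_, .step (codeAt_singleton.1 hc) (h o) hr⟩
  | @seq c c' s s' s'' t t' _ _ ih ih' =>
    intro o hc b t₀ u₀ hr
    rw [Cmd.compile, codeAt_append, Cmd.length_compile] at hc
    rw [Cmd.size, ← add_assoc] at hr
    obtain ⟨u, hu⟩ := ih' hc.2 hr
    rw [add_assoc]
    exact ih hc.1 hu
  | @ifPos a c c' s s' t ha _ ih =>
    intro o hc b t₀ u₀ hr
    simp only [Cmd.compile, codeAt_append, codeAt_singleton, Cmd.length_compile,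
      List.length_append, List.length_singleton] at hc
    obtain ⟨⟨⟨h1, h2⟩, h3⟩, h4⟩ := hc
    obtain ⟨u, hu⟩ := ih (o := o + c'.size + 2) (by convert h4 using 1; omega)
      (by convert hr using 2; simp only [Cmd.size]; omega)
    rw [add_right_comm]
    refine ⟨_, .step (u := u) h1 rfl ?_⟩
    simpa only [ha, if_true] using hu
  | @ifNonpos a c c' s s' t ha _ ih =>
    intro o hc b t₀ u₀ hr
    simp only [Cmd.compile, codeAt_append, codeAt_singleton, Cmd.length_compile,
      List.length_append, List.length_singleton] at hc
    obtain ⟨⟨⟨h1, h2⟩, h3⟩, h4⟩ := hc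
    obtain ⟨u, hu⟩ := ih h2 (Runs.step (s := ⟨o + 1 + c'.size, s', M⟩)
      (by rw [← h3]; simp [add_assoc]) rfl
      (by convert hr using 2; simp only [Cmd.size]; omega))
    rw [show t + 2 + t₀ = t + (t₀ + 1) + 1 by omega]
    refine ⟨_, .step (u := u) h1 rfl ?_⟩
    simpa only [ha, if_false] using hu
  | @whileStop a c s ha =>
    intro o hc b t₀ u₀ hr
    simp only [Cmd.compile, codeAt_append, codeAt_cons] at hc
    obtain ⟨⟨⟨h1, h2, -⟩, -⟩, -⟩ := hc
    rw [add_comm]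
    refine ⟨_, .step h1 rfl (by
      simpa only [ha, if_false] using Runs.step (s := ⟨o + 1, s, M⟩) h2 rfl hr)⟩
  | @whileStep a c s s' s'' t t' ha _ _ ih ih' =>
    intro o hc b t₀ u₀ hr
    obtain ⟨u, hu⟩ := ih' hc hr
    simp only [Cmd.compile, codeAt_append, codeAt_cons, Cmd.length_compile, List.length_append,
      List.length_cons, List.length_nil] at hc
    obtain ⟨⟨⟨h1, -⟩, h3⟩, h4, -⟩ := hc
    obtain ⟨u', hu'⟩ := ih h3 (Runs.step (s := ⟨o + 2 + c.size, s', M⟩)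
      (by rw [← h4]; simp [add_assoc]) rfl hu)
    rw [show t + t' + 2 + t₀ = t + (t' + t₀ + 1) + 1 by omega]
    refine ⟨_, .step (u := u') h1 rfl ?_⟩
    simpa only [ha, if_true] using hu'

/-! ### Weakest preconditions -/

/-- The command stops, and `Q` holds of the final registers and the number of steps. -/
def WP (M : ℕ → ℤ) (c : Cmd) (s : ℕ → ℤ) (Q : (ℕ → ℤ) → ℕ → Prop) : Prop :=
  ∃ s' t, Exec M c s s' t ∧ Q s' t

section WP

variable {M : ℕ → ℤ} {s : ℕ → ℤ} {Q : (ℕ → ℤ) → ℕ → Prop}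

theorem WP.mono {c : Cmd} {Q' : (ℕ → ℤ) → ℕ → Prop} (h : WP M c s Q)
    (hQ : ∀ s' t, Q s' t → Q' s' t) : WP M c s Q' :=
  let ⟨s', t, he, hq⟩ := h
  ⟨s', t, he, hQ s' t hq⟩

theorem WP.const {d : ℕ} {z : ℤ} (h : Q (Function.update s d z) 1) :
    WP M (.instr (.const d z)) s Q := ⟨_, _, .instr fun _ => rfl, h⟩

theorem WP.add {d a b : ℕ} (h : Q (Function.update s d (s a + s b)) 1) :
    WP M (.instr (.add d a b)) s Q := ⟨_, _, .instr fun _ => rfl, h⟩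

theorem WP.sub {d a b : ℕ} (h : Q (Function.update s d (s a - s b)) 1) :
    WP M (.instr (.sub d a b)) s Q := ⟨_, _, .instr fun _ => rfl, h⟩

theorem WP.load {d a : ℕ} (h : Q (Function.update s d (M (s a).toNat)) 1) :
    WP M (.instr (.load d a)) s Q := ⟨_, _, .instr fun _ => rfl, h⟩

theorem WP.seq {c c' : Cmd}
    (h : WP M c s fun s' t => WP M c' s' fun s'' t' => Q s'' (t + t')) :
    WP M (.seq c c') s Q :=
  let ⟨_, _, h1, _, _, h2, hq⟩ := h
  ⟨_, _, .seq h1 h2, hq⟩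

/-- The positive branch stands last in the code and falls through, so it costs only the test; the
other branch also needs a jump over it. -/
theorem WP.ifPos {a : ℕ} {c c' : Cmd} (h : 0 < s a → WP M c s fun s' t => Q s' (t + 1))
    (h' : ¬ 0 < s a → WP M c' s fun s' t => Q s' (t + 2)) : WP M (.ifPos a c c') s Q := by
  by_cases ha : 0 < s a
  · obtain ⟨_, _, h1, hq⟩ := h ha
    exact ⟨_, _, .ifPos ha h1, hq⟩
  · obtain ⟨_, _, h1, hq⟩ := h' ha
    exact ⟨_, _, .ifNonpos ha h1, hq⟩

theorem WP.whileStop {a : ℕ} {c : Cmd} (ha : ¬ 0 < s a) (h : Q s 2) :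
    WP M (.whilePos a c) s Q := ⟨_, _, .whileStop ha, h⟩

theorem WP.whileStep {a : ℕ} {c : Cmd} (ha : 0 < s a)
    (h : WP M c s fun s' t => WP M (.whilePos a c) s' fun s'' t' => Q s'' (t + t' + 2)) :
    WP M (.whilePos a c) s Q :=
  let ⟨_, _, h1, _, _, h2, hq⟩ := h
  ⟨_, _, .whileStep ha h1 h2, hq⟩

end WP

end RAM

namespace PossibleKemeny

/-! ### Scanning a chain -/

/-- The least number of inversions between a candidate with position `p` in the reference ranking
and the candidates of a chain, given by their positions; `e` and `w` are the cost of the place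
behind the part of the chain read so far and the least cost of a place in this part. If `p`
belongs to the chain, then only the inversions with the candidates in front of it count. -/
def scanCost (p : ℕ) : List ℕ → ℕ → ℕ → ℕ
  | [], _, w => w
  | q :: l, e, w =>
    if q < p then scanCost p l e (min (w + 1) e)
    else if p < q then scanCost p l (e + 1) w else e

/-- The number of inversions of a candidate with position `p` put behind `g` elements of the
chain `l`. -/
def gapCost (p : ℕ) (l : List ℕ) (g : ℕ) : ℕ :=
  (l.take g).countP (p < ·) + (l.drop g).countP (· < p)

theorem gapCost_zero (p : ℕ) (l : List ℕ) : gapCost p l 0 = l.countP (· < p) := by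
  simp [gapCost]

theorem gapCost_cons_succ (p q : ℕ) (l : List ℕ) (g : ℕ) :
    gapCost p (q :: l) (g + 1) = gapCost p l g + if p < q then 1 else 0 := by
  simp [gapCost, List.countP_cons]; omega

/-- Keeping the best place found so far costs one for each smaller entry still to come, and the scan
does at least as well. -/
theorem scanCost_le {p : ℕ} {l : List ℕ} (hp : p ∉ l) {e w : ℕ} (hw : w ≤ e) :
    scanCost p l e w ≤ w + l.countP (· < p) := by
  induction l generalizing e w with
  | nil => simp [scanCost]
  | cons q l ih =>
    simp only [List.mem_cons, not_or] at hp
    simp only [scanCost, List.countP_cons, decide_eq_true_eq]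
    split_ifs with h1 h2
    · have := ih hp.2 (min_le_right (w + 1) e)
      omega
    · have := ih hp.2 (show w ≤ e + 1 by omega)
      omega
    · omega

theorem scanCost_le_gapCost {p : ℕ} {l : List ℕ} (hp : p ∉ l) (g : ℕ) {e w : ℕ} (hw : w ≤ e) :
    scanCost p l e w ≤ e + gapCost p l g := by
  induction l generalizing e w g with
  | nil => simp [scanCost]; omega
  | cons q l ih =>
    cases g with
    | zero =>
      rw [gapCost_zero]
      exact (scanCost_le hp hw).trans (by omega)
    | succ g =>
      simp only [List.mem_cons, not_or] at hp
      rw [scanCost, gapCost_cons_succ]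
      split_ifs with h1 h2
      · omega
      · exact ih hp.2 g (min_le_right (w + 1) e)
      · have := ih hp.2 g (show w ≤ e + 1 by omega)
        omega
      · omega

theorem exists_scanCost_eq {p : ℕ} {l : List ℕ} (hp : p ∉ l) (e w : ℕ) :
    scanCost p l e w = w + l.countP (· < p) ∨
      ∃ g ≤ l.length, scanCost p l e w = e + gapCost p l g := by
  induction l generalizing e w with
  | nil => simp [scanCost]
  | cons q l ih =>
    simp only [List.mem_cons, not_or] at hp
    simp only [scanCost, List.countP_cons, decide_eq_true_eq]
    split_ifs with h1 h2
    · rcases ih hp.2 e (min (w + 1) e) with h | ⟨g, hg, h⟩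
      · rcases le_total (w + 1) e with hwe | hwe
        · left; rw [h, min_eq_left hwe]; omega
        -- Here the updated minimum is `e`, the cost of the gap just behind `q`.
        · right
          refine ⟨1, by simp, ?_⟩
          rw [h, min_eq_right hwe, gapCost_cons_succ, gapCost_zero]
          simp; omega
      · right
        refine ⟨g + 1, by simpa using hg, ?_⟩
        rw [h, gapCost_cons_succ, if_neg (by omega)]; rfl
    · rcases ih hp.2 (e + 1) w with h | ⟨g, hg, h⟩
      · left; rw [h]; omega
      · right
        refine ⟨g + 1, by simpa using hg, ?_⟩
        rw [h, gapCost_cons_succ, if_pos (by omega)]; omega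
    · omega

theorem exists_gapCost_eq_scanCost {p : ℕ} {l : List ℕ} (hp : p ∉ l) :
    ∃ g, g ≤ l.length ∧ gapCost p l g = scanCost p l 0 0 := by
  rcases exists_scanCost_eq hp 0 0 with h | ⟨g, hg, h⟩
  · exact ⟨0, by simp, by rw [h, gapCost_zero]; omega⟩
  · exact ⟨g, hg, by omega⟩

/-- Until the scan meets `p` and stops, `e` grows by one at each larger entry; `w` plays no role. -/
theorem scanCost_of_getElem {p : ℕ} {l : List ℕ} {g : ℕ} (hg : g < l.length) (h : l[g] = p)
    (hl : l.Nodup) (e w : ℕ) : scanCost p l e w = e + (l.take g).countP (p < ·) := by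
  induction l generalizing e w g with
  | nil => simp at hg
  | cons q l ih =>
    cases g with
    | zero =>
      obtain rfl : q = p := h
      simp [scanCost]
    | succ g =>
      have hg' : g < l.length := by simpa using hg
      have h' : l[g] = p := by simpa using h
      have hq : q ≠ p := by
        rintro rfl
        exact (List.nodup_cons.1 hl).1 (h' ▸ List.getElem_mem hg')
      rw [scanCost]
      simp only [ih hg' h' (List.nodup_cons.1 hl).2, List.take_succ_cons, List.countP_cons]
      split_ifs with h1 h2 h3 h4 <;> simp at * <;> omega

/-- The first place of least cost. -/
noncomputable def bestGap (p : ℕ) (l : List ℕ) : ℕ :=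
  sInf {g | g ≤ l.length ∧ gapCost p l g = scanCost p l 0 0}

theorem bestGap_spec {p : ℕ} {l : List ℕ} (hp : p ∉ l) :
    bestGap p l ≤ l.length ∧ gapCost p l (bestGap p l) = scanCost p l 0 0 :=
  Nat.sInf_mem (s := {g | g ≤ l.length ∧ gapCost p l g = scanCost p l 0 0})
    (exists_gapCost_eq_scanCost hp)

theorem lt_gapCost_of_lt_bestGap {p : ℕ} {l : List ℕ} (hp : p ∉ l) {g : ℕ}
    (hg : g < bestGap p l) : gapCost p l (bestGap p l) < gapCost p l g := by
  rw [(bestGap_spec hp).2]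
  refine lt_of_le_of_ne (by simpa using scanCost_le_gapCost hp g (le_refl 0)) fun h => ?_
  exact Nat.notMem_of_lt_sInf hg ⟨hg.le.trans (bestGap_spec hp).1, h.symm⟩

/-- When the candidate moves back past `d` entries, the larger ones become inversions and the
smaller ones cease to be. Stated additively to avoid subtraction. -/
theorem gapCost_add (p : ℕ) (l : List ℕ) (g d : ℕ) :
    gapCost p l (g + d) + ((l.drop g).take d).countP (· < p) =
      gapCost p l g + ((l.drop g).take d).countP (p < ·) := by
  have h : (l.drop g).countP (· < p) =
      ((l.drop g).take d).countP (· < p) + (l.drop (g + d)).countP (· < p) := by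
    rw [← List.drop_drop, ← List.countP_append, List.take_append_drop]
  rw [gapCost, gapCost, h, List.take_add, List.countP_append]
  omega

/-- Exchange argument. If the gap of `p` were behind that of `p'`, the stretch between them would
hold more entries below `p` than above it, because `p` strictly gains by crossing it. This holds all
the more for `p'`, so `p'` would gain too, against its optimality. -/
theorem bestGap_mono {p p' : ℕ} {l : List ℕ} (hp : p ∉ l) (hp' : p' ∉ l) (h : p ≤ p') :
    bestGap p l ≤ bestGap p' l := by
  by_contra! hlt
  obtain ⟨d, hd⟩ := Nat.exists_eq_add_of_lt hlt
  rw [add_assoc] at hd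
  have h1 := lt_gapCost_of_lt_bestGap hp hlt
  have h2 : gapCost p' l (bestGap p' l) ≤ gapCost p' l (bestGap p l) := by
    rw [(bestGap_spec hp').2]
    simpa using scanCost_le_gapCost hp' (bestGap p l) (le_refl 0)
  have h3 := gapCost_add p l (bestGap p' l) (d + 1)
  have h4 := gapCost_add p' l (bestGap p' l) (d + 1)
  rw [← hd] at h3 h4
  have h5 : ((l.drop (bestGap p' l)).take (d + 1)).countP (· < p) ≤
      ((l.drop (bestGap p' l)).take (d + 1)).countP (· < p') :=
    List.countP_mono_left fun q _ hq => by simp at *; omega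
  have h6 : ((l.drop (bestGap p' l)).take (d + 1)).countP (p' < ·) ≤
      ((l.drop (bestGap p' l)).take (d + 1)).countP (p < ·) :=
    List.countP_mono_left fun q _ hq => by simp at *; omega
  omega

/-! ### Rankings sorted by a key -/

section Keys

variable {α : Type}

theorem before_iff_lt {π : List α} {κ : α → ℕ} (h : π.Pairwise (κ · < κ ·)) {a b : α}
    (ha : a ∈ π) (hb : b ∈ π) : Before π a b ↔ κ a < κ b := by
  constructor
  · intro hab
    simpa using h.sublist hab
  · intro hab
    have hne : a ≠ b := by rintro rfl; exact hab.false
    -- Vacuous for a strict order; needed for the fact that a sorted list contained in another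
    -- sorted list is a sublist of it.
    have : Std.Antisymm (fun a b : α => κ a < κ b) := ⟨fun a b h h' => absurd h' h.asymm⟩
    refine List.sublist_of_subperm_of_pairwise (r := fun a b => κ a < κ b) ?_ (by simpa) h
    exact List.Nodup.subperm (by simpa) (by simp [ha, hb])

theorem pairwise_idxOf [DecidableEq α] {π : List α} (h : π.Nodup) :
    π.Pairwise (π.idxOf · < π.idxOf ·) := by
  rw [List.pairwise_iff_getElem]
  intro i j hi hj hij
  rwa [h.idxOf_getElem, h.idxOf_getElem]

theorem exists_forall_lt_iff_lt {R : List α} {κ : α → ℕ} (h : R.Pairwise (κ · < κ ·)) (c : ℕ) :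
    ∃ g, ∀ i (hi : i < R.length), κ R[i] < c ↔ i < g := by
  induction R with
  | nil => simp
  | cons r R ih =>
    rw [List.pairwise_cons] at h
    by_cases hr : κ r < c
    · obtain ⟨g, hg⟩ := ih h.2
      refine ⟨g + 1, fun i hi => ?_⟩
      cases i with
      | zero => simpa using hr
      | succ i => simpa using hg i (by simpa using hi)
    · refine ⟨0, fun i hi => ?_⟩
      cases i with
      | zero => simpa using hr
      | succ i =>
        have := h.1 (R[i]'(by simpa using hi)) (List.getElem_mem _)
        simp; omega

theorem countP_and_lt {R : List α} {A D : α → Prop} [DecidablePred A] [DecidablePred D] {g : ℕ}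
    (h : ∀ i (hi : i < R.length), D R[i] ↔ i < g) :
    R.countP (fun y => A y ∧ D y) = (R.take g).countP (A ·) := by
  induction R generalizing g with
  | nil => simp
  | cons r R ih =>
    have h0 : D r ↔ 0 < g := h 0 (by simp)
    have hs : ∀ i (hi : i < R.length), D R[i] ↔ i < g - 1 := fun i hi => by
      have := h (i + 1) (by simpa using hi)
      simp only [List.getElem_cons_succ] at this
      rw [this]; omega
    rw [List.countP_cons, ih hs]
    cases g with
    | zero => simp at h0; simp [h0]
    | succ g => simp at h0; simp [h0, List.countP_cons]

theorem countP_and_ge {R : List α} {A D : α → Prop} [DecidablePred A] [DecidablePred D] {g : ℕ}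
    (h : ∀ i (hi : i < R.length), D R[i] ↔ g ≤ i) :
    R.countP (fun y => A y ∧ D y) = (R.drop g).countP (A ·) := by
  induction R generalizing g with
  | nil => simp
  | cons r R ih =>
    have h0 : D r ↔ g ≤ 0 := h 0 (by simp)
    have hs : ∀ i (hi : i < R.length), D R[i] ↔ g - 1 ≤ i := fun i hi => by
      have := h (i + 1) (by simpa using hi)
      simp only [List.getElem_cons_succ] at this
      rw [this]; omega
    rw [List.countP_cons, ih hs]
    cases g with
    | zero => simp at h0; simp [h0, List.countP_cons]
    | succ g => simp at h0; simp [h0]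

theorem exists_ranking_pairwise [Fintype α] {κ : α → ℕ} (hκ : Function.Injective κ) :
    ∃ π : List α, IsRanking π ∧ π.Pairwise (κ · < κ ·) := by
  have : Std.Total (fun a b : α => κ a ≤ κ b) := ⟨fun a b => le_total _ _⟩
  have : Std.Antisymm (fun a b : α => κ a ≤ κ b) := ⟨fun a b h h' => hκ (le_antisymm h h')⟩
  have : IsTrans α (fun a b : α => κ a ≤ κ b) := ⟨fun a b c h h' => h.trans h'⟩
  refine ⟨Finset.univ.sort fun a b => κ a ≤ κ b, ⟨Finset.sort_nodup _ _, by simp⟩, ?_⟩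
  refine (List.Pairwise.and (Finset.pairwise_sort _ _) (Finset.sort_nodup _ _)).imp ?_
  rintro a b ⟨h, hne⟩
  exact lt_of_le_of_ne h (hκ.ne hne)

/-! ### Charging inversions to candidates, and the optimal extension -/

variable [DecidableEq α]

/-- The inversions of the orders given by `pos` and `κ` between `x` and elements of `R`, where a
pair of elements of `R` is attributed to the one with the smaller value of `pos`. -/
def share (pos κ : α → ℕ) (R : List α) (x : α) : ℕ :=
  R.countP (fun y => pos x < pos y ∧ κ y < κ x) +
    if x ∈ R then 0 else R.countP (fun y => pos y < pos x ∧ κ x < κ y)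

theorem share_of_notMem {pos κ : α → ℕ} {R : List α} {x : α} (hκ : Function.Injective κ)
    (hx : x ∉ R) {g : ℕ} (h : ∀ i (hi : i < R.length), κ R[i] < κ x ↔ i < g) :
    share pos κ R x = gapCost (pos x) (R.map pos) g := by
  have h' : ∀ i (hi : i < R.length), κ x < κ R[i] ↔ g ≤ i := fun i hi => by
    have h1 := h i hi
    have h2 : κ R[i] ≠ κ x := fun he => hx (hκ he ▸ List.getElem_mem hi)
    omega
  rw [share, if_neg hx, countP_and_lt h, countP_and_ge h', gapCost, ← List.map_take,
    ← List.map_drop, List.countP_map, List.countP_map]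
  rfl

theorem share_of_mem {pos κ : α → ℕ} {R : List α} {x : α} (hp : Function.Injective pos)
    (hR : R.Pairwise (κ · < κ ·)) (hx : x ∈ R) :
    share pos κ R x = scanCost (pos x) (R.map pos) 0 0 := by
  obtain ⟨g, hg, rfl⟩ := List.getElem_of_mem hx
  have hR' := List.pairwise_iff_getElem.1 hR
  have h : ∀ i (hi : i < R.length), κ R[i] < κ R[g] ↔ i < g := fun i hi => by
    rcases lt_trichotomy i g with h | rfl | h
    · simpa [h] using hR' i g hi hg h
    · simp
    · have := hR' g i hg hi h
      omega
  have hn : R.Nodup := hR.imp fun {a b} hab he => by subst he; exact hab.false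
  rw [share, if_pos hx, countP_and_lt h, scanCost_of_getElem (g := g) (by simpa) (by simp)
    (hn.map hp), ← List.map_take, List.countP_map]
  simp [Function.comp_def]

theorem scanCost_le_share {pos κ : α → ℕ} {R : List α} (hp : Function.Injective pos)
    (hκ : Function.Injective κ) (hR : R.Pairwise (κ · < κ ·)) (x : α) :
    scanCost (pos x) (R.map pos) 0 0 ≤ share pos κ R x := by
  by_cases hx : x ∈ R
  · exact (share_of_mem hp hR hx).ge
  · obtain ⟨g, hg⟩ := exists_forall_lt_iff_lt hR (κ x)
    rw [share_of_notMem hκ hx hg]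
    have : pos x ∉ R.map pos := by rwa [List.mem_map_of_injective hp]
    simpa using scanCost_le_gapCost this g (le_refl 0)

theorem IsRanking.idxOf_injective {π : List α} (hπ : IsRanking π) :
    Function.Injective (π.idxOf ·) := fun x _ h => (List.idxOf_inj (hπ.2 x)).1 h

/-- The key of a candidate in an optimal extension of `R`: the elements of `R` keep their order,
and the others are put into their best gaps, ordered as in `π`. -/
noncomputable def extensionKey (π R : List α) (x : α) : ℕ :=
  if x ∈ R then (2 * R.idxOf x + 1) * (π.length + 1)
  else 2 * bestGap (π.idxOf x) (R.map π.idxOf) * (π.length + 1) + π.idxOf x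

/-- With N = `π.length + 1`, the entry of index i has the odd multiple (2i + 1)N as its key, and a
missing candidate in gap g has a key between 2gN and (2g + 1)N. -/
theorem extensionKey_lt_iff {π R : List α} (hR : R.Nodup) {x : α} (hx : x ∉ R) {i : ℕ}
    (hi : i < R.length) :
    extensionKey π R R[i] < extensionKey π R x ↔ i < bestGap (π.idxOf x) (R.map π.idxOf) := by
  rw [extensionKey, extensionKey, if_pos (List.getElem_mem hi), if_neg hx, hR.idxOf_getElem]
  generalize bestGap (π.idxOf x) (R.map π.idxOf) = g
  have : π.idxOf x ≤ π.length := List.idxOf_le_length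
  constructor
  · intro h
    by_contra! hle
    nlinarith [Nat.mul_le_mul_right (π.length + 1) hle]
  · intro h
    nlinarith [Nat.mul_le_mul_right (π.length + 1) (Nat.succ_le_of_lt h)]

theorem extensionKey_lt_of_lt {π R : List α} (hπ : IsRanking π) {x y : α} (hx : x ∉ R)
    (hy : y ∉ R) (h : π.idxOf x < π.idxOf y) : extensionKey π R x < extensionKey π R y := by
  rw [extensionKey, extensionKey, if_neg hx, if_neg hy]
  have := bestGap_mono (l := R.map π.idxOf) (p := π.idxOf x) (p' := π.idxOf y)
    (by rwa [List.mem_map_of_injective hπ.idxOf_injective])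
    (by rwa [List.mem_map_of_injective hπ.idxOf_injective]) h.le
  have := Nat.mul_le_mul_right (π.length + 1) (Nat.mul_le_mul_left 2 this)
  omega

theorem extensionKey_pairwise {π R : List α} (hR : R.Nodup) :
    R.Pairwise (extensionKey π R · < extensionKey π R ·) := by
  rw [List.pairwise_iff_getElem]
  intro i j hi hj hij
  rw [extensionKey, extensionKey, if_pos (List.getElem_mem hi), if_pos (List.getElem_mem hj),
    hR.idxOf_getElem, hR.idxOf_getElem]
  exact Nat.mul_lt_mul_of_pos_right (by omega) (by omega)

theorem extensionKey_injective {π R : List α} (hπ : IsRanking π) (hR : R.Nodup) :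
    Function.Injective (extensionKey π R) := by
  have hmix : ∀ x y, x ∈ R → y ∉ R → extensionKey π R x ≠ extensionKey π R y := by
    intro x y hx hy h
    have hlt : π.idxOf y < π.length := List.idxOf_lt_length_of_mem (hπ.2 y)
    rw [extensionKey, extensionKey, if_pos hx, if_neg hy] at h
    -- Modulo `π.length + 1` the two keys are 0 and the position of `y`. So this position is 0, and
    -- division leaves an odd number equal to an even one.
    have h1 := congrArg (· % (π.length + 1)) h
    simp only [Nat.mul_mod_left, Nat.mul_add_mod', Nat.mod_eq_of_lt (Nat.lt_succ_of_lt hlt)] at h1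
    rw [← h1, add_zero] at h
    have := Nat.eq_of_mul_eq_mul_right (by omega) h
    omega
  intro x y h
  by_cases hx : x ∈ R <;> by_cases hy : y ∈ R
  · obtain ⟨i, hi, rfl⟩ := List.getElem_of_mem hx
    obtain ⟨j, hj, rfl⟩ := List.getElem_of_mem hy
    have hp := List.pairwise_iff_getElem.1 (extensionKey_pairwise (π := π) hR)
    rcases lt_trichotomy i j with hij | rfl | hij
    · exact absurd h (hp i j hi hj hij).ne
    · rfl
    · exact absurd h (hp j i hj hi hij).ne'
  · exact absurd h (hmix x y hx hy)
  · exact absurd h.symm (hmix y x hy hx)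
  · rcases lt_trichotomy (π.idxOf x) (π.idxOf y) with hxy | hxy | hxy
    · exact absurd h (extensionKey_lt_of_lt hπ hx hy hxy).ne
    · exact hπ.idxOf_injective hxy
    · exact absurd h (extensionKey_lt_of_lt hπ hy hx hxy).ne'

/-! ### The least distance as a sum over candidates -/

variable [Fintype α]

/-- Swapping the names in the second count of `share` makes each inversion that meets `R` appear
exactly once, with its `pos`-smaller member first. -/
theorem sum_share {R : List α} (hR : R.Nodup) (pos κ : α → ℕ) :
    ∑ x, share pos κ R x =
      ∑ x, ∑ y, if (pos x < pos y ∧ κ y < κ x) ∧ (x ∈ R ∨ y ∈ R) then 1 else 0 := by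
  have hc : ∀ (A : α → Prop) [DecidablePred A],
      R.countP (A ·) = ∑ y, if A y ∧ y ∈ R then 1 else 0 := fun A _ => by
    rw [← Finset.card_filter, List.countP_eq_length_filter,
      ← List.toFinset_card_of_nodup (hR.filter _)]
    congr 1
    ext y; simp [and_comm]
  have h1 : ∀ x, share pos κ R x =
      (∑ y, if (pos x < pos y ∧ κ y < κ x) ∧ y ∈ R then 1 else 0) +
        ∑ y, if (pos y < pos x ∧ κ x < κ y) ∧ x ∉ R ∧ y ∈ R then 1 else 0 := fun x => by
    rw [share, hc (fun y => pos x < pos y ∧ κ y < κ x), hc (fun y => pos y < pos x ∧ κ x < κ y)]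
    by_cases hx : x ∈ R <;> simp [hx]
  simp_rw [h1]
  rw [Finset.sum_add_distrib, Finset.sum_comm (f := fun x y =>
    if (pos y < pos x ∧ κ x < κ y) ∧ x ∉ R ∧ y ∈ R then 1 else 0), ← Finset.sum_add_distrib]
  refine Finset.sum_congr rfl fun x _ => ?_
  rw [← Finset.sum_add_distrib]
  refine Finset.sum_congr rfl fun y _ => ?_
  by_cases hx : x ∈ R <;> by_cases hy : y ∈ R <;> simp [hx, hy]

theorem kendallTau_eq_sum {π π' : List α} (hπ : IsRanking π) {κ : α → ℕ} (hπ' : ∀ c, c ∈ π')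
    (hκ : π'.Pairwise (κ · < κ ·)) :
    kendallTau π π' =
      ∑ x, ∑ y, if π.idxOf x < π.idxOf y ∧ κ y < κ x then 1 else 0 := by
  rw [kendallTau, Finset.card_filter, ← Finset.univ_product_univ, Finset.sum_product]
  simp only [before_iff_lt (pairwise_idxOf hπ.1) (hπ.2 _) (hπ.2 _),
    before_iff_lt hκ (hπ' _) (hπ' _)]

/-- The least distance of `π` from a ranking that extends `R`. -/
def minCost (π R : List α) : ℕ :=
  ∑ x, scanCost (π.idxOf x) (R.map π.idxOf) 0 0

theorem minCost_le_kendallTau {π R R' : List α} (hπ : IsRanking π) (h : Extends R' R) :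
    minCost π R ≤ kendallTau π R' := by
  have hκ := pairwise_idxOf h.1.1
  rw [kendallTau_eq_sum hπ h.1.2 hκ]
  calc minCost π R ≤ ∑ x, share π.idxOf R'.idxOf R x :=
        Finset.sum_le_sum fun x _ =>
          scanCost_le_share hπ.idxOf_injective h.1.idxOf_injective (hκ.sublist h.2) x
    _ ≤ _ := by
      rw [sum_share (h.1.1.sublist h.2)]
      refine Finset.sum_le_sum fun x _ => Finset.sum_le_sum fun y _ => ?_
      split_ifs with h1 h2 <;> simp_all

theorem exists_extends_kendallTau_eq {π R : List α} (hπ : IsRanking π) (hR : R.Nodup) :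
    ∃ R', Extends R' R ∧ kendallTau π R' = minCost π R := by
  have hinj := extensionKey_injective hπ hR
  obtain ⟨R', hR', hs⟩ := exists_ranking_pairwise hinj
  have hRs := extensionKey_pairwise (π := π) hR
  refine ⟨R', ⟨hR', ?_⟩, ?_⟩
  · have : Std.Antisymm (fun a b : α => extensionKey π R a < extensionKey π R b) :=
      ⟨fun a b h h' => absurd h' h.asymm⟩
    exact List.sublist_of_subperm_of_pairwise (hR.subperm fun x _ => hR'.2 x) hRs hs
  · rw [kendallTau_eq_sum hπ hR'.2 hs]
    have h : ∀ x, scanCost (π.idxOf x) (R.map π.idxOf) 0 0 =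
        share π.idxOf (extensionKey π R) R x := fun x => by
      by_cases hx : x ∈ R
      · exact (share_of_mem hπ.idxOf_injective hRs hx).symm
      · rw [share_of_notMem hinj hx fun i hi => extensionKey_lt_iff hR hx hi]
        exact (bestGap_spec (by rwa [List.mem_map_of_injective hπ.idxOf_injective])).2.symm
    simp_rw [minCost, h]
    rw [sum_share hR]
    refine Finset.sum_congr rfl fun x _ => Finset.sum_congr rfl fun y _ => ?_
    -- Restricting to pairs that meet `R` loses nothing, since missing candidates have keys ordered
    -- as in `π`.
    refine if_congr ⟨fun hxy => ⟨hxy, ?_⟩, fun hxy => hxy.1⟩ rfl rfl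
    by_contra! hn
    exact (extensionKey_lt_of_lt hπ hn.1 hn.2 hxy.1).asymm hxy.2

end Keys

theorem Input.isYes_iff (I : Input) :
    I.IsYes ↔ ((∑ i, minCost I.X (I.rankings i) : ℕ) : ℤ) ≤ I.k := by
  constructor
  · rintro ⟨R', h, hk⟩
    refine le_trans ?_ hk
    exact_mod_cast Finset.sum_le_sum fun i _ => minCost_le_kendallTau I.X_isRanking (h i)
  · intro hk
    choose R' h h' using fun i =>
      exists_extends_kendallTau_eq I.X_isRanking (I.rankings_nodup i)
    exact ⟨R', h, by simpa [h'] using hk⟩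

end PossibleKemeny

namespace PossibleKemeny

open RAM

/-! ### Lists in the memory -/

/-- The list `l` stands in the memory from the cell `a` on. -/
def Stored (M : ℕ → ℤ) : ℕ → List ℤ → Prop
  | _, [] => True
  | a, z :: l => M a = z ∧ Stored M (a + 1) l

theorem stored_append {M : ℕ → ℤ} {a : ℕ} {l l' : List ℤ} :
    Stored M a (l ++ l') ↔ Stored M a l ∧ Stored M (a + l.length) l' := by
  induction l generalizing a with
  | nil => simp [Stored]
  | cons z l ih => simp [Stored, ih, and_assoc, add_assoc, add_comm 1]

theorem stored_of_getD {M : ℕ → ℤ} {a : ℕ} {l : List ℤ}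
    (h : ∀ i < l.length, M (a + i) = l.getD i 0) : Stored M a l := by
  induction l generalizing a with
  | nil => trivial
  | cons z l ih =>
    refine ⟨by simpa using h 0 (by simp), ih fun i hi => ?_⟩
    have := h (i + 1) (by simpa using hi)
    rw [add_assoc, add_comm 1, this, List.getD_cons_succ]

/-! ### The program

Register `0` holds `0`, register `1` holds `1`, and the others hold:
`2`: the number of candidates; `3`: the number of rankings left; `4`: the address of the current
ranking; `5`: its length; `6`: the remaining budget; `7`: the address of the current candidate in
the reference ranking; `8`: the number of candidates left; `9` and `10`: the two costs of
`scanCost`; `11`: the number of entries left in the ranking; `12`: the address of the current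
entry; `13`: this entry; `14`: its address in the reference ranking; `15` and `16`: auxiliary. -/

infixr:60 " ;; " => Cmd.seq

/-- Read the next entry of the reference ranking and compare it with register `13`. -/
def findBody : Cmd :=
  .instr (.add 14 14 1) ;; .instr (.load 16 14) ;; .instr (.sub 15 16 13) ;;
    .ifPos 15 (.instr (.const 15 1)) (.instr (.sub 15 13 16))

/-- Compute the address in the reference ranking of the candidate in register `13`. -/
def find : Cmd :=
  .instr (.const 14 2) ;; .instr (.const 15 1) ;; .whilePos 15 findBody

/-- Update the costs after the position of the current entry has been found. -/
def updateCosts : Cmd :=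
  .instr (.sub 15 7 14) ;;
    .ifPos 15
      (.instr (.add 10 10 1) ;; .instr (.sub 15 10 9) ;;
        .ifPos 15 (.instr (.add 10 9 0)) (.instr (.const 15 0)))
      (.instr (.sub 15 14 7) ;;
        .ifPos 15 (.instr (.add 9 9 1)) (.instr (.add 10 9 0) ;; .instr (.const 11 0)))

/-- One step of `scanCost`. -/
def scanBody : Cmd :=
  .instr (.add 12 12 1) ;; .instr (.sub 11 11 1) ;; .instr (.load 13 12) ;; find ;; updateCosts

/-- Subtract the cost of the current candidate from the budget and go to the next candidate. -/
def candidateBody : Cmd :=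
  .instr (.const 9 0) ;; .instr (.const 10 0) ;; .instr (.add 11 5 0) ;; .instr (.add 12 4 0) ;;
    .whilePos 11 scanBody ;; .instr (.sub 6 6 10) ;; .instr (.add 7 7 1) ;; .instr (.sub 8 8 1)

/-- Subtract the cost of the current ranking from the budget and go to the next ranking. -/
def rankingBody : Cmd :=
  .instr (.load 5 4) ;; .instr (.const 7 3) ;; .instr (.add 8 2 0) ;;
    .whilePos 8 candidateBody ;;
    .instr (.add 4 4 5) ;; .instr (.add 4 4 1) ;; .instr (.sub 3 3 1)

/-- Make register `6` positive if and only if the answer is yes. -/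
def solve : Cmd :=
  .instr (.const 1 1) ;; .instr (.load 6 0) ;; .instr (.load 2 1) ;; .instr (.const 5 2) ;;
    .instr (.load 3 5) ;; .instr (.const 4 3) ;; .instr (.add 4 4 2) ;;
    .ifPos 2 (.whilePos 3 rankingBody) (.instr (.const 5 0)) ;; .instr (.add 6 6 1)

/-- The program that decides the problem. -/
def program : Program :=
  solve.compile 0 ++ [.jumpPos 6 (solve.size + 2), .halt false, .halt true]

/-! ### Correctness of the program -/

section Correctness

variable {M : ℕ → ℤ} {s : ℕ → ℤ} {m : ℕ}

/-- Jumps test only for positive values, so inequality is tested by the differences in both orders.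
-/
theorem wp_findBody (h1 : s 1 = 1) :
    WP M findBody s fun s' t => s' 14 = s 14 + 1 ∧
      (0 < s' 15 ↔ M (s 14 + 1).toNat ≠ s 13) ∧ (∀ i < 14, s' i = s i) ∧ t ≤ 6 := by
  refine .seq (.add (.seq (.load (.seq (.sub (.ifPos (fun h => .const ?_) fun h => .sub ?_))))))
  all_goals
    simp only [Function.update_apply, Nat.reduceEqDiff, if_true, if_false, h1] at h ⊢
    refine ⟨trivial, by omega, fun i hi => ?_, by omega⟩
    simp [show i ≠ 14 by omega, show i ≠ 15 by omega, show i ≠ 16 by omega]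

theorem wp_findLoop {a : ℕ} {X : List (Fin m)} {c : Fin m} (hX : Stored M (a + 1) (wordsOf X))
    (hc : c ∈ X) (h1 : s 1 = 1) (h13 : s 13 = (c : ℕ)) (h14 : s 14 = a) (h15 : 0 < s 15) :
    WP M (.whilePos 15 findBody) s fun s' t => s' 14 = a + 1 + X.idxOf c ∧
      (∀ i < 14, s' i = s i) ∧ t ≤ 8 * X.length + 2 := by
  induction X generalizing a s with
  | nil => simp at hc
  | cons x X ih =>
    obtain ⟨hx, hX⟩ := hX
    refine .whileStep h15 ((wp_findBody h1).mono ?_)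
    rintro s' t ⟨h14', h15', hs', ht⟩
    have ha : (s 14 + 1).toNat = a + 1 := by omega
    rw [ha, hx, h13] at h15'
    by_cases hxc : x = c
    · subst hxc
      refine .whileStop (by simp [h15']) ⟨by simp [h14', h14], hs', ?_⟩
      simp; omega
    · refine (ih (a := a + 1) hX (by simpa [Ne.symm hxc] using hc) (by rw [hs' 1 (by omega), h1])
        (by rw [hs' 13 (by omega), h13]) (by rw [h14', h14]; rfl) ?_).mono ?_
      · rw [h15']
        exact fun h => hxc (Fin.ext (Int.ofNat_inj.1 h))
      · rintro s'' t' ⟨h14'', hs'', ht'⟩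
        refine ⟨?_, fun i hi => by rw [hs'' i hi, hs' i hi], ?_⟩
        · rw [h14'', List.idxOf_cons_ne _ hxc]
          push_cast; ring
        · simp; omega

theorem wp_find {X : List (Fin m)} {c : Fin m} (hX : Stored M 3 (wordsOf X)) (hc : c ∈ X)
    (h1 : s 1 = 1) (h13 : s 13 = (c : ℕ)) :
    WP M find s fun s' t => s' 14 = 3 + X.idxOf c ∧ (∀ i < 14, s' i = s i) ∧
      t ≤ 8 * X.length + 4 := by
  -- `X` begins at cell 3, but the loop increments the address before reading, hence the start at 2.
  refine .seq (.const (.seq (.const ((wp_findLoop (a := 2) hX hc ?_ ?_ ?_ ?_).mono ?_))))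
  · simpa
  · simpa
  · simp
  · simp
  · rintro s' t ⟨h14, hs', ht⟩
    refine ⟨by rw [h14]; rfl, fun i hi => ?_, by omega⟩
    rw [hs' i hi]
    simp [show i ≠ 14 by omega, show i ≠ 15 by omega]

theorem wp_updateCosts {p q e w : ℕ} (h0 : s 0 = 0) (h1 : s 1 = 1) (h7 : s 7 = 3 + p)
    (h9 : s 9 = e) (h10 : s 10 = w) (h14 : s 14 = 3 + q) :
    WP M updateCosts s fun s' t =>
      (q < p → s' 9 = e ∧ s' 10 = (min (w + 1) e : ℕ) ∧ s' 11 = s 11) ∧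
      (p < q → s' 9 = (e + 1 : ℕ) ∧ s' 10 = w ∧ s' 11 = s 11) ∧
      (p = q → s' 10 = e ∧ s' 11 = 0) ∧
      s' 12 = s 12 ∧ (∀ i < 9, s' i = s i) ∧ t ≤ 9 := by
  refine .seq (.sub (.ifPos (fun h => .seq (.add (.seq (.sub (.ifPos (fun h' => .add ?_)
    fun h' => .const ?_))))) fun h => .seq (.sub (.ifPos (fun h' => .add ?_)
    fun h' => .seq (.add (.const ?_))))))
  all_goals
    simp only [Function.update_apply, Nat.reduceEqDiff, OfNat.one_ne_ofNat, if_true,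
      if_false, true_and, and_true, h0, h1, h7, h9, h10, h14] at h h' ⊢
    refine ⟨by omega, by omega, by omega, fun i hi => ?_, by omega⟩
    simp [show i ≠ 9 by omega, show i ≠ 10 by omega, show i ≠ 11 by omega, show i ≠ 15 by omega]

theorem wp_scanBody {X : List (Fin m)} {c : Fin m} {a p e w : ℕ} (hX : Stored M 3 (wordsOf X))
    (hc : c ∈ X) (hM : M (a + 1) = (c : ℕ)) (h0 : s 0 = 0) (h1 : s 1 = 1) (h7 : s 7 = 3 + p)
    (h9 : s 9 = e) (h10 : s 10 = w) (h12 : s 12 = a) :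
    WP M scanBody s fun s' t =>
      (X.idxOf c < p → s' 9 = e ∧ s' 10 = (min (w + 1) e : ℕ) ∧ s' 11 = s 11 - 1) ∧
      (p < X.idxOf c → s' 9 = (e + 1 : ℕ) ∧ s' 10 = w ∧ s' 11 = s 11 - 1) ∧
      (p = X.idxOf c → s' 10 = e ∧ s' 11 = 0) ∧
      s' 12 = (a + 1 : ℕ) ∧ (∀ i < 9, s' i = s i) ∧ t ≤ 8 * X.length + 16 := by
  refine .seq (.add (.seq (.sub (.seq (.load (.seq ((wp_find hX hc ?_ ?_).mono ?_)))))))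
  · simpa
  · have : (s 12 + s 1).toNat = a + 1 := by omega
    simp [this, hM]
  · rintro s' t ⟨h14, hs', ht⟩
    have hs : ∀ i < 11, s' i = s i := fun i hi => by
      rw [hs' i (by omega)]
      simp [show i ≠ 11 by omega, show i ≠ 12 by omega,
        show i ≠ 13 by omega]
    have h11' : s' 11 = s 11 - 1 := by
      rw [hs' 11 (by omega)]; simp [h1]
    have h12' : s' 12 = (a + 1 : ℕ) := by
      rw [hs' 12 (by omega)]; simp [h1, h12]
    refine (wp_updateCosts (p := p) (e := e) (w := w) (by rw [hs 0 (by omega), h0])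
      (by rw [hs 1 (by omega), h1]) (by rw [hs 7 (by omega), h7]) (by rw [hs 9 (by omega), h9])
      (by rw [hs 10 (by omega), h10]) h14).mono ?_
    rintro s'' t' ⟨hlt, hgt, heq, h12'', hs'', ht'⟩
    rw [h11'] at hlt hgt
    exact ⟨hlt, hgt, heq, h12''.trans h12',
      fun i hi => by rw [hs'' i hi, hs i (by omega)], by omega⟩

theorem wp_scanLoop {X R : List (Fin m)} {a p e w : ℕ} (hX : Stored M 3 (wordsOf X))
    (hX' : ∀ c, c ∈ X) (hR : Stored M (a + 1) (wordsOf R)) (h0 : s 0 = 0) (h1 : s 1 = 1)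
    (h7 : s 7 = 3 + p) (h9 : s 9 = e) (h10 : s 10 = w) (h11 : s 11 = R.length)
    (h12 : s 12 = a) :
    WP M (.whilePos 11 scanBody) s fun s' t => s' 10 = scanCost p (R.map X.idxOf) e w ∧
      (∀ i < 9, s' i = s i) ∧ t ≤ R.length * (8 * X.length + 18) + 2 := by
  induction R generalizing a e w s with
  | nil =>
    refine .whileStop (by simp [h11]) ⟨by simpa [scanCost], fun _ _ => rfl, by simp⟩
  | cons c R ih =>
    obtain ⟨hc, hR⟩ := hR
    refine .whileStep (by simp [h11])
      ((wp_scanBody hX (hX' c) hc h0 h1 h7 h9 h10 h12).mono ?_)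
    rintro s' t ⟨hlt, hgt, heq, h12', hs', ht⟩
    simp only [List.map_cons, scanCost, List.length_cons, Nat.cast_add, Nat.cast_one] at h11 ⊢
    have h0' : s' 0 = 0 := by rw [hs' 0 (by omega), h0]
    have h1' : s' 1 = 1 := by rw [hs' 1 (by omega), h1]
    have h7' : s' 7 = 3 + p := by rw [hs' 7 (by omega), h7]
    have hcont : ∀ (s'' : ℕ → ℤ) (t' : ℕ) (z : ℤ), (s'' 10 = z ∧ (∀ i < 9, s'' i = s' i) ∧
        t' ≤ R.length * (8 * X.length + 18) + 2) → s'' 10 = z ∧ (∀ i < 9, s'' i = s i) ∧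
        t + t' + 2 ≤ (R.length + 1) * (8 * X.length + 18) + 2 := by
      rintro s'' t' z ⟨hz, hs'', ht'⟩
      refine ⟨hz, fun i hi => by rw [hs'' i hi, hs' i hi], ?_⟩
      rw [add_mul]; omega
    split_ifs with hp hp'
    · obtain ⟨h9', h10', h11'⟩ := hlt hp
      exact (ih hR h0' h1' h7' h9' h10' (by rw [h11', h11]; ring) h12').mono
        fun s'' t' => hcont s'' t' _
    · obtain ⟨h9', h10', h11'⟩ := hgt hp'
      exact (ih hR h0' h1' h7' h9' h10' (by rw [h11', h11]; ring) h12').mono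
        fun s'' t' => hcont s'' t' _
    · obtain ⟨h10', h11'⟩ := heq (by omega)
      exact .whileStop (by simp [h11']) (hcont _ _ _ ⟨h10', fun _ _ => rfl, by omega⟩)

theorem wp_candidateBody {X R : List (Fin m)} {a p : ℕ} (hX : Stored M 3 (wordsOf X))
    (hX' : ∀ c, c ∈ X) (hR : Stored M (a + 1) (wordsOf R)) (h0 : s 0 = 0) (h1 : s 1 = 1)
    (h4 : s 4 = a) (h5 : s 5 = R.length) (h7 : s 7 = 3 + p) :
    WP M candidateBody s fun s' t => s' 6 = s 6 - scanCost p (R.map X.idxOf) 0 0 ∧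
      s' 7 = 3 + (p + 1 : ℕ) ∧ s' 8 = s 8 - 1 ∧ (∀ i < 6, s' i = s i) ∧
      t ≤ R.length * (8 * X.length + 18) + 9 := by
  refine .seq (.const (.seq (.const (.seq (.add (.seq (.add (.seq
    ((wp_scanLoop (a := a) (p := p) (e := 0) (w := 0) hX hX' hR ?_ ?_ ?_ ?_ ?_ ?_ ?_).mono
      ?_)))))))))
  iterate 7 simp [*]
  rintro s' t ⟨h10, hs', ht⟩
  have hs : ∀ i < 9, s' i = s i := fun i hi => by
    rw [hs' i (by omega)]
    simp [show i ≠ 9 by omega, show i ≠ 10 by omega,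
      show i ≠ 11 by omega, show i ≠ 12 by omega]
  refine .seq (.sub (.seq (.add (.sub ?_))))
  simp only [Function.update_apply, Nat.reduceEqDiff, OfNat.one_ne_ofNat, if_true, if_false,
    h10, hs 1 (by omega), hs 6 (by omega),
    hs 7 (by omega), hs 8 (by omega), h1, h7]
  refine ⟨trivial, by push_cast; ring, trivial, fun i hi => ?_, by omega⟩
  simp [show i ≠ 6 by omega, show i ≠ 7 by omega, show i ≠ 8 by omega, hs i (by omega)]

theorem wp_candidateLoop {X R : List (Fin m)} {a p j : ℕ} (hX : Stored M 3 (wordsOf X))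
    (hX' : ∀ c, c ∈ X) (hR : Stored M (a + 1) (wordsOf R)) (h0 : s 0 = 0) (h1 : s 1 = 1)
    (h4 : s 4 = a) (h5 : s 5 = R.length) (h7 : s 7 = 3 + p) (h8 : s 8 = j) :
    WP M (.whilePos 8 candidateBody) s fun s' t =>
      s' 6 = s 6 - (∑ i ∈ Finset.range j, scanCost (p + i) (R.map X.idxOf) 0 0 : ℕ) ∧
      (∀ i < 6, s' i = s i) ∧ t ≤ j * (R.length * (8 * X.length + 18) + 11) + 2 := by
  induction j generalizing p s with
  | zero => exact .whileStop (by simp [h8]) ⟨by simp, fun _ _ => rfl, by omega⟩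
  | succ j ih =>
    refine .whileStep (by simp [h8])
      ((wp_candidateBody hX hX' hR h0 h1 h4 h5 h7).mono ?_)
    rintro s' t ⟨h6', h7', h8', hs', ht⟩
    refine (ih (by rw [hs' 0 (by omega), h0]) (by rw [hs' 1 (by omega), h1])
      (by rw [hs' 4 (by omega), h4]) (by rw [hs' 5 (by omega), h5]) h7'
      (by rw [h8', h8]; push_cast; ring)).mono ?_
    rintro s'' t' ⟨h6'', hs'', ht'⟩
    refine ⟨?_, fun i hi => by rw [hs'' i hi, hs' i hi], ?_⟩
    · rw [h6'', h6', Finset.sum_range_succ']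
      simp only [add_assoc, add_comm 1, add_zero]
      push_cast; ring
    · rw [add_mul]; omega

/-- The machine runs through positions in `X`, whereas `minCost` sums over candidates. -/
theorem sum_range_scanCost {X : List (Fin m)} (hX : IsRanking X) (R : List (Fin m)) :
    ∑ i ∈ Finset.range X.length, scanCost i (R.map X.idxOf) 0 0 = minCost X R := by
  symm
  refine Finset.sum_nbij X.idxOf (fun x _ => ?_) (fun x _ y _ h => hX.idxOf_injective h)
    (fun p hp => ?_) fun _ _ => rfl
  · exact Finset.mem_range.2 (List.idxOf_lt_length_of_mem (hX.2 x))
  · have hp : p < X.length := by simpa using hp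
    exact ⟨X[p], by simp, hX.1.idxOf_getElem p hp⟩

theorem IsRanking.length_eq {X : List (Fin m)} (hX : IsRanking X) : X.length = m := by
  rw [← List.toFinset_card_of_nodup hX.1, show X.toFinset = Finset.univ by ext; simp [hX.2]]
  simp

theorem wp_rankingBody {X R : List (Fin m)} {a : ℕ} (hX : Stored M 3 (wordsOf X))
    (hX' : IsRanking X) (hR : Stored M a ((R.length : ℤ) :: wordsOf R)) (hR' : R.length ≤ m)
    (h0 : s 0 = 0) (h1 : s 1 = 1) (h2 : s 2 = m) (h4 : s 4 = a) :
    WP M rankingBody s fun s' t => s' 6 = s 6 - minCost X R ∧ s' 3 = s 3 - 1 ∧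
      s' 4 = (a + (R.length + 1) : ℕ) ∧ (∀ i < 3, s' i = s i) ∧
      t ≤ m * (m * (8 * m + 18) + 11) + 8 := by
  have ha : (s 4).toNat = a := by omega
  refine .seq (.load (.seq (.const (.seq (.add (.seq ((wp_candidateLoop (a := a) (p := 0) (j := m)
    hX hX'.2 hR.2 ?_ ?_ ?_ ?_ ?_ ?_).mono ?_)))))))
  iterate 3 simp [*]
  · simp [ha, hR.1]
  iterate 2 simp [*]
  rintro s' t ⟨h6, hs', ht⟩
  have hs : ∀ i < 5, s' i = s i := fun i hi => by
    rw [hs' i (by omega)]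
    simp [show i ≠ 5 by omega, show i ≠ 7 by omega, show i ≠ 8 by omega]
  have h5 : s' 5 = R.length := by
    rw [hs' 5 (by omega)]; simp [ha, hR.1]
  have h6' : s' 6 = s 6 - minCost X R := by
    rw [h6, ← sum_range_scanCost hX', hX'.length_eq]
    simp
  refine .seq (.add (.seq (.add (.sub ?_))))
  simp only [Function.update_apply, Nat.reduceEqDiff, OfNat.one_ne_ofNat, if_true, if_false,
    h5, h6', hs 1 (by omega), hs 3 (by omega),
    hs 4 (by omega), h1, h4]
  refine ⟨trivial, trivial, by push_cast; ring, fun i hi => ?_, ?_⟩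
  · simp [show i ≠ 3 by omega, show i ≠ 4 by omega, hs i (by omega)]
  · rw [hX'.length_eq] at ht
    have := Nat.mul_le_mul_left m (Nat.add_le_add_right
      (Nat.mul_le_mul_right (8 * m + 18) hR') 11)
    omega

theorem wp_rankingLoop {X : List (Fin m)} {Rs : List (List (Fin m))} {a : ℕ}
    (hX : Stored M 3 (wordsOf X)) (hX' : IsRanking X)
    (hRs : Stored M a (Rs.flatMap fun R => (R.length : ℤ) :: wordsOf R))
    (hRs' : ∀ R ∈ Rs, R.length ≤ m) (h0 : s 0 = 0) (h1 : s 1 = 1) (h2 : s 2 = m)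
    (h3 : s 3 = Rs.length) (h4 : s 4 = a) :
    WP M (.whilePos 3 rankingBody) s fun s' t =>
      s' 6 = s 6 - ((Rs.map (minCost X)).sum : ℕ) ∧ (∀ i < 3, s' i = s i) ∧
      t ≤ Rs.length * (m * (m * (8 * m + 18) + 11) + 10) + 2 := by
  induction Rs generalizing a s with
  | nil => exact .whileStop (by simp [h3]) ⟨by simp, fun _ _ => rfl, by omega⟩
  | cons R Rs ih =>
    rw [List.flatMap_cons, stored_append] at hRs
    refine .whileStep (by simp [h3])
      ((wp_rankingBody hX hX' hRs.1 (hRs' R (by simp)) h0 h1 h2 h4).mono ?_)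
    rintro s' t ⟨h6', h3', h4', hs', ht⟩
    refine (ih (by simpa [wordsOf] using hRs.2) (fun R' h => hRs' R' (by simp [h]))
      (by rw [hs' 0 (by omega), h0]) (by rw [hs' 1 (by omega), h1])
      (by rw [hs' 2 (by omega), h2]) (by rw [h3', h3]; simp) h4').mono ?_
    rintro s'' t' ⟨h6'', hs'', ht'⟩
    refine ⟨?_, fun i hi => by rw [hs'' i hi, hs' i hi], ?_⟩
    · rw [h6'', h6']
      simp; ring
    · rw [List.length_cons, add_mul]; omega

theorem wp_solve (I : Input) :
    WP (init I.encode).mem solve (fun _ => 0) fun s' t =>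
      s' 6 = I.k - (∑ i, minCost I.X (I.rankings i) : ℕ) + 1 ∧
      t ≤ 50 * (I.n * I.m ^ 3 + 1) := by
  have hM : Stored (init I.encode).mem 0 I.encode :=
    stored_of_getD fun i _ => by simp [init]
  rw [Input.encode, stored_append, stored_append] at hM
  obtain ⟨⟨hM₀, hX⟩, hRs⟩ := hM
  -- Unfolding the encoding also unfolded it inside the memory; it is folded back so that the memory
  -- can be generalized.
  rw [show (init ([I.k, (I.m : ℤ), (I.n : ℤ)] ++ wordsOf I.X ++
    (List.ofFn I.rankings).flatMap fun R => (R.length : ℤ) :: wordsOf R)).mem =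
    (init I.encode).mem from rfl] at hM₀ hX hRs
  have hk : (init I.encode).mem 0 = I.k := hM₀.1
  have hm : (init I.encode).mem 1 = I.m := hM₀.2.1
  have hn : (init I.encode).mem 2 = I.n := hM₀.2.2.1
  generalize (init I.encode).mem = M at *
  have hlen : (0 + ([I.k, (I.m : ℤ), (I.n : ℤ)] ++ wordsOf I.X).length) = 3 + I.m := by
    simp [wordsOf, I.X_isRanking.length_eq]; omega
  rw [hlen] at hRs
  refine .seq (.const (.seq (.load (.seq (.load (.seq (.const (.seq (.load (.seq (.const (.seq
    (.add (.seq (.ifPos (fun h => ?_) fun h => .const (.add ?_))))))))))))))))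
  · refine (wp_rankingLoop (a := 3 + I.m) hX I.X_isRanking hRs ?_ ?_ ?_ ?_ ?_ ?_).mono ?_
    · intro R hR
      obtain ⟨i, rfl⟩ := (List.mem_ofFn' _ _).1 hR
      simpa using (I.rankings_nodup i).length_le_card
    iterate 5 simp [*]
    rintro s' t ⟨h6, hs', ht⟩
    refine .add ⟨?_, ?_⟩
    · simp [h6, hs', hk, List.sum_ofFn, List.map_ofFn]
    · simp [hm] at h
      rw [List.length_ofFn] at ht
      -- For m ≥ 1 every power is at most m³, and 8 + 18 + 11 + 10 = 47.
      have hm2 : I.m * (I.m * (8 * I.m + 18) + 11) + 10 ≤ 47 * I.m ^ 3 := by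
        have h2 : 1 ≤ I.m ^ 2 := Nat.one_le_pow _ _ h
        nlinarith [Nat.mul_le_mul h h2, Nat.mul_le_mul_left I.m h2,
          Nat.mul_le_mul_right (I.m ^ 2) h]
      have := Nat.mul_le_mul_left I.n hm2
      nlinarith
  -- Without candidates the program skips the rankings: the bound is then constant, while n may be
  -- large. All costs are 0.
  · simp only [Function.update_apply] at h ⊢
    simp only [Nat.reduceEqDiff, OfNat.one_ne_ofNat,
      OfNat.ofNat_ne_one, zero_ne_one,
      if_true, if_false, Int.toNat_one, Int.toNat_zero, hm, hk] at h ⊢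
    have h0 : I.m = 0 := by omega
    refine ⟨?_, by omega⟩
    have : IsEmpty (Fin I.m) := by rw [h0]; infer_instance
    simp [minCost]

end Correctness

/-! ### The running time in terms of the length of the input -/

theorem length_le_bitLength (w : List ℤ) : w.length ≤ bitLength w := by
  induction w with
  | nil => simp
  | cons z w ih =>
    have : 1 ≤ bits z := Nat.le_add_left _ _
    simp only [bitLength, List.map_cons, List.sum_cons, List.length_cons] at *
    omega

theorem bits_le_bitLength {w : List ℤ} {z : ℤ} (hz : z ∈ w) : bits z ≤ bitLength w :=
  List.le_sum_of_mem (List.mem_map_of_mem hz)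

/-- The additional one covers the value 0, which has one bit even when `w` is empty. -/
theorem init_bitBound (w : List ℤ) : (init w).BitBound (bitLength w + 1) := by
  refine ⟨fun i => by simp [init, bits], fun i => ?_⟩
  show bits (w.getD i 0) ≤ _
  rcases lt_or_ge i w.length with hi | hi
  · rw [List.getD_eq_getElem _ _ hi]
    exact (bits_le_bitLength (List.getElem_mem hi)).trans (Nat.le_succ _)
  · rw [List.getD_eq_default _ _ hi]
    simp [bits]

theorem length_le_length_flatMap {α β : Type} {f : α → List β} (hf : ∀ a, 1 ≤ (f a).length)
    (l : List α) : l.length ≤ (l.flatMap f).length := by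
  induction l with
  | nil => simp
  | cons a l ih =>
    have := hf a
    simp only [List.flatMap_cons, List.length_append, List.length_cons]
    omega

theorem Input.m_add_n_le (I : Input) : I.m + I.n ≤ bitLength I.encode := by
  refine le_trans ?_ (length_le_bitLength _)
  have := length_le_length_flatMap (f := fun R : List (Fin I.m) => (R.length : ℤ) :: wordsOf R)
    (by simp) (List.ofFn I.rankings)
  rw [List.length_ofFn] at this
  have hX : (wordsOf I.X).length = I.m := by simp [wordsOf, I.X_isRanking.length_eq]
  rw [Input.encode, List.length_append, List.length_append, hX]
  omega

theorem exists_bits_const_le (P : Program) :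
    ∃ B, ∀ d c, Instr.const d c ∈ P → bits c ≤ B := by
  induction P with
  | nil => simp
  | cons i P ih =>
    obtain ⟨B, hB⟩ := ih
    by_cases hi : ∃ d c, i = .const d c
    · obtain ⟨d, c, rfl⟩ := hi
      refine ⟨B + bits c, fun d' c' h => ?_⟩
      rcases List.mem_cons.1 h with h | h
      · cases h; omega
      · have := hB d' c' h; omega
    · refine ⟨B, fun d c h => ?_⟩
      rcases List.mem_cons.1 h with h | h
      · exact absurd ⟨d, c, h.symm⟩ hi
      · exact hB d c h

theorem runs_program (I : Input) : ∃ (b : Bool) (t u : ℕ),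
    Runs program (init I.encode) b t u ∧ (b = true ↔ I.IsYes) ∧
      t ≤ 60 * (I.n * I.m ^ 3 + 1) := by
  obtain ⟨s, t, hs, h6, ht⟩ := wp_solve I
  have hcode : CodeAt program 0 program := fun j hj => by
    rw [zero_add, List.getElem?_eq_getElem hj]
  rw [program, codeAt_append, Cmd.length_compile, codeAt_cons, codeAt_cons, codeAt_singleton,
    ← program] at hcode
  obtain ⟨hc, h1, h2, h3⟩ := hcode
  have hstart : init I.encode = ⟨0, fun _ => 0, (init I.encode).mem⟩ := rfl
  rw [hstart, Input.isYes_iff]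
  by_cases hpos : 0 < s 6
  · obtain ⟨u, hu⟩ := Runs.of_exec hs hc (b := true) (t' := 2) (.step h1 rfl
      (.halt (by simpa only [hpos, if_true, zero_add] using h3)))
    exact ⟨true, _, u, hu, by simp only [true_iff]; omega, by omega⟩
  · obtain ⟨u, hu⟩ := Runs.of_exec hs hc (b := false) (t' := 2) (.step h1 rfl
      (.halt (by simpa only [hpos, if_false] using h2)))
    exact ⟨false, _, u, hu, by simp only [Bool.false_eq_true, false_iff]; omega, by omega⟩

end PossibleKemeny

open Polynomial in
theorem mainTheorem1 :
    ∃ (P : RAM.Program) (C : ℕ) (p : Polynomial ℕ),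
      ∀ I : PossibleKemeny.Input, ∃ (b : Bool) (t u : ℕ),
        RAM.Runs P (RAM.init I.encode) b t u ∧
        (b = true ↔ I.IsYes) ∧
        t ≤ C * (I.n * I.m ^ 3 + 1) ∧
        u ≤ p.eval (RAM.bitLength I.encode) := by
  obtain ⟨B, hB⟩ := PossibleKemeny.exists_bits_const_le PossibleKemeny.program
  -- The polynomial is the bound of `Runs.bitCost_le` with n and m replaced by the input length L
  -- and with initial bit bound L + 1 + `B`, where `B` bounds the constants of the program.
  refine ⟨PossibleKemeny.program, 60,
    (60 * (X * X ^ 3 + 1)) * (1 + 2 * (X + 1 + C B + 60 * (X * X ^ 3 + 1))), fun I => ?_⟩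
  obtain ⟨b, t, u, hr, hb, ht⟩ := PossibleKemeny.runs_program I
  refine ⟨b, t, u, hr, hb, ht, ?_⟩
  have hu := hr.bitCost_le (RAM.bitLength I.encode + 1 + B)
    (by
      obtain ⟨h, h'⟩ := PossibleKemeny.init_bitBound I.encode
      exact ⟨fun i => (h i).trans (by omega), fun i => (h' i).trans (by omega)⟩)
    fun d c h => (hB d c h).trans (by omega)
  have hmn := I.m_add_n_le
  generalize RAM.bitLength I.encode = L at *
  have ht' : t ≤ 60 * (L * L ^ 3 + 1) := ht.trans (Nat.mul_le_mul_left _ (Nat.add_le_add_right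
    (Nat.mul_le_mul (by omega) (Nat.pow_le_pow_left (by omega) 3)) 1))
  refine hu.trans ?_
  simp only [eval_mul, eval_add, eval_pow, eval_X, eval_C, eval_one, eval_ofNat]
  exact Nat.mul_le_mul ht' (by omega)
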